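/- Let $0<R_1<R_2$, let $\Omega=\{x\in\mathbb R^2: R_1<|x|<R_2\}$, let $\Gamma_i=\{|x|=R_i\}$ for $i=1,2$, and let $n$ be the unit outer normal of $\partial\Omega=\Gamma_1\cup\Gamma_2$. Let $v_*\in L^2(\partial\Omega;\mathbb R^2)$ (in particular, $v_*$ may be any element of $W^{1/2,2}(\partial\Omega)$) satisfy $$\Phi:=\int_{\Gamma_2}v_*\cdot n\,ds=-\int_{\Gamma_1}v_*\cdot n\,ds,\qquad \Phi>0 .$$ Then the Leray–Hopf Extension Condition fails for $v_*$. That is, the following statement is false: for every $\varepsilon>0$ there is a vector field $V_\varepsilon\in W^{1,2}(\Omega)$ with $\operatorname{div}V_\varepsilon=0$ in $\Omega$ and with trace $v_*$ on $\partial\Omega$ such that $$-\int_\Omega \sum_{i,j=1}^2 u_i\,(\partial_i V_{\varepsilon,j})\,u_j\,dx\;\le\;\varepsilon\int_\Omega\sum_{i,j=1}^2(\partial_i u_j)^2\,dx$$ for all $u\in W^{1,2}_0(\Omega;\mathbb R^2)$ with $\operatorname{div}u=0$ in $\Omega$. -/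

import Mathlib

open MeasureTheory Filter Topology Set
open scoped ContDiff

noncomputable section

/-- The Euclidean plane. -/
abbrev Plane : Type := EuclideanSpace ℝ (Fin 2)

/-- The classical partial derivative `∂φ/∂xᵢ`. -/
def partialDeriv {F : Type*} [NormedAddCommGroup F] [NormedSpace ℝ F]
    (i : Fin 2) (φ : Plane → F) (x : Plane) : F :=
  fderiv ℝ φ x (EuclideanSpace.single i 1)

/-- `G i` is the weak partial derivative `∂V/∂xᵢ` in `Ω` of the vector field `V`, for `i = 0, 1`. -/
def IsWeakGradient (Ω : Set Plane) (V : Plane → Plane) (G : Fin 2 → Plane → Plane) : Prop :=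
  ∀ φ : Plane → ℝ, ContDiff ℝ ∞ φ → HasCompactSupport φ → tsupport φ ⊆ Ω →
    ∀ i j : Fin 2,
      ∫ x in Ω, V x j * partialDeriv i φ x = - ∫ x in Ω, G i x j * φ x

/-- `V ∈ W^{1,2}(Ω)`, with weak gradient `G`. -/
structure MemW12 (Ω : Set Plane) (V : Plane → Plane) (G : Fin 2 → Plane → Plane) : Prop where
  memLp : MemLp V 2 (volume.restrict Ω)
  memLp_grad : ∀ i, MemLp (G i) 2 (volume.restrict Ω)
  isWeakGradient : IsWeakGradient Ω V G

/-- The fields `φ k` converge to `V` in the norm of `W^{1,2}(Ω)`, where `G` is the weak gradient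
of `V`. -/
def TendstoW12 (Ω : Set Plane) (φ : ℕ → Plane → Plane) (V : Plane → Plane)
    (G : Fin 2 → Plane → Plane) : Prop :=
  Tendsto (fun k => eLpNorm (fun x => φ k x - V x) 2 (volume.restrict Ω)) atTop (𝓝 0) ∧
  ∀ i, Tendsto (fun k => eLpNorm (fun x => partialDeriv i (φ k) x - G i x) 2
    (volume.restrict Ω)) atTop (𝓝 0)

/-- `u ∈ W₀^{1,2}(Ω)`, with weak gradient `H`: the field `u` is a limit in `W^{1,2}(Ω)` of smooth
fields with compact support in `Ω`. -/
def MemW12Zero (Ω : Set Plane) (u : Plane → Plane) (H : Fin 2 → Plane → Plane) : Prop :=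
  MemW12 Ω u H ∧ ∃ φ : ℕ → Plane → Plane,
    (∀ k, ContDiff ℝ ∞ (φ k) ∧ HasCompactSupport (φ k) ∧ tsupport (φ k) ⊆ Ω) ∧
    TendstoW12 Ω φ u H

/-- A field with weak gradient `G` is solenoidal in `Ω`: its divergence vanishes almost everywhere
in `Ω`. -/
def IsSolenoidal (Ω : Set Plane) (G : Fin 2 → Plane → Plane) : Prop :=
  ∀ᵐ x ∂(volume.restrict Ω), ∑ i, G i x i = 0

/-- The field `V ∈ W^{1,2}(Ω)`, with weak gradient `G`, has the trace `g` on the boundary of `Ω`,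
where `σ` is the surface measure of the boundary. The trace operator is the continuous extension
to `W^{1,2}(Ω)`, with values in `L²(σ)`, of the restriction to the boundary of fields that are
smooth up to the boundary. -/
def HasTrace (Ω : Set Plane) (σ : Measure Plane) (V : Plane → Plane)
    (G : Fin 2 → Plane → Plane) (g : Plane → Plane) : Prop :=
  ∃ φ : ℕ → Plane → Plane, (∀ k, ContDiff ℝ ∞ (φ k)) ∧ TendstoW12 Ω φ V G ∧
    Tendsto (fun k => eLpNorm (fun x => φ k x - g x) 2 σ) atTop (𝓝 0)

/-- `(u · ∇V, u) = ∫_Ω uᵢ (∂ᵢ Vⱼ) uⱼ`, where `G` is the weak gradient of `V`. -/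
def convectiveForm (Ω : Set Plane) (G : Fin 2 → Plane → Plane) (u : Plane → Plane) : ℝ :=
  ∫ x in Ω, ∑ i, ∑ j, u x i * G i x j * u x j

/-- `‖∇u‖₂² = ∫_Ω (∂ᵢ uⱼ) (∂ᵢ uⱼ)`, where `H` is the weak gradient of `u`. -/
def dirichletEnergy (Ω : Set Plane) (H : Fin 2 → Plane → Plane) : ℝ :=
  ∫ x in Ω, ∑ i, ∑ j, (H i x j) ^ 2

/-- The Leray–Hopf Extension Condition for the boundary data `vStar` on a plane domain `Ω` whose
boundary has the surface measure `σ`. -/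
def LerayHopfExtensionCondition (Ω : Set Plane) (σ : Measure Plane) (vStar : Plane → Plane) :
    Prop :=
  ∀ ε : ℝ, 0 < ε → ∃ (V : Plane → Plane) (G : Fin 2 → Plane → Plane),
    MemW12 Ω V G ∧ IsSolenoidal Ω G ∧ HasTrace Ω σ V G vStar ∧
    ∀ (u : Plane → Plane) (H : Fin 2 → Plane → Plane),
      MemW12Zero Ω u H → IsSolenoidal Ω H →
        -convectiveForm Ω G u ≤ ε * dirichletEnergy Ω H

/-- The open annulus `{R₁ < |x| < R₂}`. -/
def annulus (R₁ R₂ : ℝ) : Set Plane := {x | R₁ < ‖x‖ ∧ ‖x‖ < R₂}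

/-- The arc length measure of the circle `|x| = R`, that is, `R dθ` in the polar angle. -/
def arcLength (R : ℝ) : Measure Plane :=
  ENNReal.ofReal R •
    (volume.restrict (Ioc 0 (2 * Real.pi))).map
      (fun θ : ℝ => (!₂[R * Real.cos θ, R * Real.sin θ] : Plane))

/-- The arc length measure of the boundary of the annulus. -/
def annulusBoundaryMeasure (R₁ R₂ : ℝ) : Measure Plane := arcLength R₁ + arcLength R₂

/-- The radial unit vector `e_r = x / |x|`. The unit normal that points out of the annulus is `e_r`
on the outer circle and `-e_r` on the inner circle. -/
def radialUnit (x : Plane) : Plane := ‖x‖⁻¹ • x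

end

/-! The obstruction is a pair of test fields whose combined convective term depends on an extension
`V` only through the flux `Φ`. Take the stream functions `Re` and `Im` of `β(r²) r² e^{i(2m+2)θ}`.
Being a quarter period apart, they give fields `u` for which the sum of `u ⊗ u` loses its angular
dependence and its mixed term: it is `4(m+1)² r² β² e_r ⊗ e_r + 4 r² (β + sβ')² e_θ ⊗ e_θ`, with `s
= r²`. Since `e_r ⊗ e_r = I - e_θ ⊗ e_θ` and `I` pairs with `∇V` to `div V = 0`, the sum of `-u ⊗ u`
acts as `streamWeight β m (r²)` times `x^⊥ ⊗ x^⊥` (`sum_streamField_quadratic`). The `θθ` component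
of `∇V` is `(∂_θ V_θ + V_r) / r`. Its angular derivative integrates to zero over each circle and,
for solenoidal `V`, the integral of `V_r` is the flux. The two forms therefore add up to `c = Φ ∫
w(r²) r dr`, with `w` the weight (`integral_annulus_perp_eq_flux`). For `V` only in `W^{1,2}` this
comes from an identity for smooth, not necessarily solenoidal fields
(`integral_annulus_radial_weight`), passed to the limit. A large wave number makes the integral of
`w` positive (`exists_streamWeight_integral_pos`), so `c > 0`. The test fields, hence `c` and their
total Dirichlet energy `K`, do not depend on `ε` or `V`, and `c ≤ ε K` fails for small `ε`. -/

/-! ### Classical partial derivatives -/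

section PartialDerivatives

variable {F : Type*} [NormedAddCommGroup F] [NormedSpace ℝ F]

theorem ContDiff.partialDeriv {φ : Plane → F} (hφ : ContDiff ℝ ∞ φ) (i : Fin 2) :
    ContDiff ℝ ∞ (partialDeriv i φ) :=
  (hφ.fderiv_right (m := ∞) (by simp)).clm_apply contDiff_const

theorem tsupport_partialDeriv_subset (i : Fin 2) (φ : Plane → F) :
    tsupport (partialDeriv i φ) ⊆ tsupport φ :=
  tsupport_fderiv_apply_subset ℝ (EuclideanSpace.single i 1)

theorem HasCompactSupport.partialDeriv {φ : Plane → F} (hφ : HasCompactSupport φ) (i : Fin 2) :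
    HasCompactSupport (partialDeriv i φ) :=
  hφ.fderiv_apply ℝ (EuclideanSpace.single i 1)

theorem partialDeriv_coord {u : Plane → Plane} {x : Plane} (hu : DifferentiableAt ℝ u x)
    (i j : Fin 2) : partialDeriv i (fun y => u y j) x = partialDeriv i u x j := by
  have h := ((EuclideanSpace.proj (𝕜 := ℝ) j : Plane →L[ℝ] ℝ).hasFDerivAt.comp x
    hu.hasFDerivAt).fderiv
  have h' : fderiv ℝ (fun y => u y j) x
    = (EuclideanSpace.proj (𝕜 := ℝ) j : Plane →L[ℝ] ℝ).comp (fderiv ℝ u x) := h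
  simp [partialDeriv, h']

theorem partialDeriv_comm {ψ : Plane → F} (hψ : ContDiff ℝ ∞ ψ) (i j : Fin 2) (x : Plane) :
    partialDeriv i (partialDeriv j ψ) x = partialDeriv j (partialDeriv i ψ) x := by
  have hd : Differentiable ℝ (fderiv ℝ ψ) :=
    (hψ.fderiv_right (m := ∞) (by simp)).differentiable (by simp)
  have key : ∀ a b : Fin 2, partialDeriv a (partialDeriv b ψ) x =
      fderiv ℝ (fderiv ℝ ψ) x (EuclideanSpace.single a 1) (EuclideanSpace.single b 1) := by
    intro a b
    have h := ((hd x).hasFDerivAt.clm_apply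
      (hasFDerivAt_const (EuclideanSpace.single b (1 : ℝ) : Plane) x)).fderiv
    have h' : fderiv ℝ (partialDeriv b ψ) x = _ := h
    rw [partialDeriv, h']
    simp
  rw [key, key]
  exact (hψ.contDiffAt.isSymmSndFDerivAt (by
    rw [minSmoothness_of_isRCLikeNormedField]
    exact WithTop.coe_le_coe.2 le_top)) _ _

end PartialDerivatives

/-! ### Smooth test fields and stream functions -/

theorem isWeakGradient_partialDeriv {u : Plane → Plane} (hu : ContDiff ℝ ∞ u) (Ω : Set Plane) :
    IsWeakGradient Ω u (fun i => partialDeriv i u) := by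
  intro φ hφ hc hs i j
  have huj : ContDiff ℝ ∞ (fun y => u y j) := by fun_prop
  have hz : ∀ x ∉ Ω, φ x = 0 := fun x hx => image_eq_zero_of_notMem_tsupport fun h => hx (hs h)
  have hz' : ∀ x ∉ Ω, partialDeriv i φ x = 0 := fun x hx =>
    image_eq_zero_of_notMem_tsupport fun h => hx (hs (tsupport_partialDeriv_subset i φ h))
  rw [setIntegral_eq_integral_of_forall_compl_eq_zero (fun x hx => by rw [hz' x hx, mul_zero]),
    setIntegral_eq_integral_of_forall_compl_eq_zero (fun x hx => by rw [hz x hx, mul_zero])]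
  have hcoord : ∀ x, fderiv ℝ (fun y => u y j) x (EuclideanSpace.single i 1)
      = partialDeriv i u x j := fun x =>
    partialDeriv_coord (hu.differentiable (by simp) x) i j
  have hcd : Continuous fun x => partialDeriv i u x j := by
    have := (hu.partialDeriv i).continuous
    fun_prop
  have := integral_mul_fderiv_eq_neg_fderiv_mul_of_integrable (μ := (volume : Measure Plane))
    (f := fun y => u y j) (g := φ) (v := EuclideanSpace.single i 1)
    (by simp_rw [hcoord]
        exact (hcd.mul hφ.continuous).integrable_of_hasCompactSupport hc.mul_left)
    ((huj.continuous.mul (hφ.partialDeriv i).continuous).integrable_of_hasCompactSupport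
      (hc.partialDeriv i).mul_left)
    ((huj.continuous.mul hφ.continuous).integrable_of_hasCompactSupport hc.mul_left)
    (fun x _ => huj.differentiable (by simp) x) (fun x _ => hφ.differentiable (by simp) x)
  simp_rw [hcoord] at this
  exact this

theorem memW12Zero_of_contDiff {u : Plane → Plane} {Ω : Set Plane} (hu : ContDiff ℝ ∞ u)
    (hc : HasCompactSupport u) (hs : tsupport u ⊆ Ω) :
    MemW12Zero Ω u (fun i => partialDeriv i u) :=
  ⟨⟨hu.continuous.memLp_of_hasCompactSupport hc,
    fun i => (hu.partialDeriv i).continuous.memLp_of_hasCompactSupport (hc.partialDeriv i),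
    isWeakGradient_partialDeriv hu Ω⟩,
    fun _ => u, fun _ => ⟨hu, hc, hs⟩, by simp, fun i => by simp⟩

/-- The solenoidal field with the stream function `ψ`. -/
noncomputable def streamField (ψ : Plane → ℝ) (x : Plane) : Plane :=
  !₂[partialDeriv 1 ψ x, -partialDeriv 0 ψ x]

theorem contDiff_streamField {ψ : Plane → ℝ} (hψ : ContDiff ℝ ∞ ψ) :
    ContDiff ℝ ∞ (streamField ψ) := by
  rw [contDiff_euclidean]
  intro i
  fin_cases i
  · exact hψ.partialDeriv 1
  · exact (hψ.partialDeriv 0).neg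

theorem tsupport_streamField_subset (ψ : Plane → ℝ) :
    tsupport (streamField ψ) ⊆ tsupport ψ := by
  refine closure_minimal (fun x hx => ?_) (isClosed_tsupport ψ)
  by_contra h
  refine hx ?_
  have hz : ∀ i, partialDeriv i ψ x = 0 := fun i =>
    image_eq_zero_of_notMem_tsupport fun h' => h (tsupport_partialDeriv_subset i ψ h')
  ext i
  fin_cases i <;> simp [streamField, hz]

theorem memW12Zero_streamField {ψ : Plane → ℝ} {Ω : Set Plane} (hψ : ContDiff ℝ ∞ ψ)
    (hc : HasCompactSupport ψ) (hs : tsupport ψ ⊆ Ω) :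
    MemW12Zero Ω (streamField ψ) (fun i => partialDeriv i (streamField ψ)) :=
  memW12Zero_of_contDiff (contDiff_streamField hψ)
    (hc.of_isClosed_subset (isClosed_tsupport _) (tsupport_streamField_subset ψ))
    ((tsupport_streamField_subset ψ).trans hs)

theorem isSolenoidal_streamField {ψ : Plane → ℝ} (hψ : ContDiff ℝ ∞ ψ) (Ω : Set Plane) :
    IsSolenoidal Ω (fun i => partialDeriv i (streamField ψ)) := by
  refine Eventually.of_forall fun x => ?_
  have hd := (contDiff_streamField hψ).differentiable (by simp) x
  rw [Fin.sum_univ_two, ← partialDeriv_coord hd, ← partialDeriv_coord hd]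
  have h0 : (fun y => streamField ψ y 0) = partialDeriv 1 ψ := rfl
  have h1 : (fun y => streamField ψ y 1) = -partialDeriv 0 ψ := rfl
  have hneg : partialDeriv 1 (-partialDeriv 0 ψ) x = -partialDeriv 1 (partialDeriv 0 ψ) x := by
    rw [partialDeriv, fderiv_neg]
    rfl
  rw [h0, h1, hneg, partialDeriv_comm hψ 0 1, add_neg_cancel]

/-! ### Polar coordinates and the divergence theorem in the annulus -/

theorem hasDerivAt_plane {f : ℝ → Plane} {f' : Plane} {t : ℝ} :
    HasDerivAt f f' t ↔ ∀ i, HasDerivAt (fun s => f s i) (f' i) t := by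
  refine ⟨fun h i => (EuclideanSpace.proj (𝕜 := ℝ) i : Plane →L[ℝ] ℝ).hasFDerivAt.comp_hasDerivAt
    t h, fun h => ?_⟩
  exact (EuclideanSpace.equiv (Fin 2) ℝ).symm.toContinuousLinearMap.hasFDerivAt.comp_hasDerivAt t
    (hasDerivAt_pi.2 h)

/-- The parametrization `(r, θ) ↦ (r cos θ, r sin θ)` of the plane. -/
noncomputable def polarPoint (p : ℝ × ℝ) : Plane := !₂[p.1 * Real.cos p.2, p.1 * Real.sin p.2]

theorem contDiff_polarPoint : ContDiff ℝ ∞ polarPoint := by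
  rw [contDiff_euclidean]
  intro i
  fin_cases i
  · exact contDiff_fst.mul (Real.contDiff_cos.comp contDiff_snd)
  · exact contDiff_fst.mul (Real.contDiff_sin.comp contDiff_snd)

theorem norm_sq_eq_coord (x : Plane) : ‖x‖ ^ 2 = x 0 ^ 2 + x 1 ^ 2 := by
  simp [EuclideanSpace.norm_sq_eq, Fin.sum_univ_two]

theorem norm_polarPoint {r : ℝ} (hr : 0 ≤ r) (θ : ℝ) : ‖polarPoint (r, θ)‖ = r := by
  rw [← abs_of_nonneg (norm_nonneg (polarPoint (r, θ))), ← abs_of_nonneg hr, ← sq_eq_sq_iff_abs_eq_abs,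
    norm_sq_eq_coord]
  simp only [polarPoint, PiLp.toLp_apply, Matrix.cons_val_zero, Matrix.cons_val_one, abs_of_nonneg hr]
  linear_combination r ^ 2 * Real.sin_sq_add_cos_sq θ

theorem measurableSet_annulus (R₁ R₂ : ℝ) : MeasurableSet (annulus R₁ R₂) :=
  (measurableSet_lt measurable_const measurable_norm).inter
    (measurableSet_lt measurable_norm measurable_const)

/-- Integration over the annulus in polar coordinates. -/
theorem integral_annulus_eq_polar {R₁ R₂ : ℝ} (hR₁ : 0 < R₁) (f : Plane → ℝ) :
    ∫ x in annulus R₁ R₂, f x =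
      ∫ p in Ioo R₁ R₂ ×ˢ Ioo (-Real.pi) Real.pi, p.1 * f (polarPoint p) := by
  have e : MeasurePreserving
      (((MeasurableEquiv.toLp 2 (Fin 2 → ℝ)).symm.trans MeasurableEquiv.finTwoArrow).symm)
      (volume : Measure (ℝ × ℝ)) (volume : Measure Plane) :=
    ((volume_preserving_finTwoArrow ℝ).comp
      (EuclideanSpace.volume_preserving_symm_measurableEquiv_toLp (Fin 2))).symm
        ((MeasurableEquiv.toLp 2 (Fin 2 → ℝ)).symm.trans MeasurableEquiv.finTwoArrow)
  rw [← integral_indicator (measurableSet_annulus R₁ R₂), ← e.integral_comp',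
    ← integral_comp_polarCoord_symm, polarCoord_target,
    ← integral_indicator (measurableSet_Ioi.prod measurableSet_Ioo),
    ← integral_indicator (measurableSet_Ioo.prod measurableSet_Ioo)]
  congr 1
  ext p
  have hp : ∀ q, (((MeasurableEquiv.toLp 2 (Fin 2 → ℝ)).symm.trans MeasurableEquiv.finTwoArrow).symm)
      (polarCoord.symm q) = polarPoint q := fun _ => rfl
  simp only [hp]
  obtain ⟨r, θ⟩ := p
  by_cases hr : 0 < r
  · have hmem : polarPoint (r, θ) ∈ annulus R₁ R₂ ↔ r ∈ Ioo R₁ R₂ := by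
      simp [annulus, norm_polarPoint hr.le]
    by_cases hθ : θ ∈ Ioo (-Real.pi) Real.pi
    · by_cases hm : r ∈ Ioo R₁ R₂
      · rw [indicator_of_mem (mk_mem_prod (mem_Ioi.2 hr) hθ), indicator_of_mem (mk_mem_prod hm hθ),
          indicator_of_mem (hmem.2 hm), smul_eq_mul]
      · rw [indicator_of_mem (mk_mem_prod (mem_Ioi.2 hr) hθ), indicator_of_notMem (fun h => hm (hmem.1 h)),
          indicator_of_notMem (fun h => hm h.1), smul_zero]
    · rw [indicator_of_notMem (fun h => hθ h.2), indicator_of_notMem (fun h => hθ h.2)]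
  · rw [indicator_of_notMem (fun h => hr h.1), indicator_of_notMem (fun h => hr (hR₁.trans h.1.1))]

/-- The flux through a circle in the polar angle. -/
theorem integral_arcLength_radial {R : ℝ} (hR : 0 < R) {φ : Plane → Plane} (hφ : Continuous φ) :
    ∫ x, inner ℝ (φ x) (radialUnit x) ∂(arcLength R) =
      ∫ θ in -Real.pi..Real.pi, R * (φ (polarPoint (R, θ)) 0 * Real.cos θ +
        φ (polarPoint (R, θ)) 1 * Real.sin θ) := by
  have hP : Continuous fun θ : ℝ => polarPoint (R, θ) :=
    contDiff_polarPoint.continuous.comp (by fun_prop)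
  have hP' : (fun θ : ℝ => (!₂[R * Real.cos θ, R * Real.sin θ] : Plane)) =
      fun θ => polarPoint (R, θ) := rfl
  have hm : Measurable radialUnit := (measurable_norm.inv).smul measurable_id
  rw [arcLength, integral_smul_measure, hP', integral_map hP.measurable.aemeasurable
    (hφ.measurable.inner hm).aestronglyMeasurable, ENNReal.toReal_ofReal hR.le,
    ← intervalIntegral.integral_of_le (by positivity), smul_eq_mul,
    ← intervalIntegral.integral_const_mul]
  -- Arc length uses angles in `(0, 2π]` and polar coordinates use `(-π, π)`; periodicity moves one
  -- range to the other.
  have hper : Function.Periodic (fun θ => R * inner ℝ (φ (polarPoint (R, θ)))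
      (radialUnit (polarPoint (R, θ)))) (2 * Real.pi) := by
    intro θ
    have : polarPoint (R, θ + 2 * Real.pi) = polarPoint (R, θ) := by simp [polarPoint]
    simp only [this]
  have h := hper.intervalIntegral_add_eq 0 (-Real.pi)
  rw [zero_add, show -Real.pi + 2 * Real.pi = Real.pi by ring] at h
  rw [h]
  refine intervalIntegral.integral_congr fun θ _ => ?_
  simp only [radialUnit, norm_polarPoint hR.le]
  simp only [polarPoint, PiLp.inner_apply, Fin.sum_univ_two, PiLp.smul_apply,
    Matrix.cons_val_zero, Matrix.cons_val_one, smul_eq_mul, RCLike.inner_apply, conj_trivial]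
  field_simp

/-- The field `x^⊥ = (-x₁, x₀)`. -/
noncomputable def perp (x : Plane) : Plane := !₂[-x 1, x 0]

theorem hasDerivAt_coord_polarPoint_fst {φ : Plane → Plane} (hφ : ContDiff ℝ ∞ φ) (r θ : ℝ)
    (j : Fin 2) : HasDerivAt (fun t => φ (polarPoint (t, θ)) j)
      (Real.cos θ * partialDeriv 0 φ (polarPoint (r, θ)) j +
        Real.sin θ * partialDeriv 1 φ (polarPoint (r, θ)) j) r := by
  have hP : HasDerivAt (fun t => polarPoint (t, θ))
      (Real.cos θ • EuclideanSpace.single 0 1 + Real.sin θ • EuclideanSpace.single 1 1) r := by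
    rw [hasDerivAt_plane]
    intro i
    fin_cases i
    · simpa [polarPoint] using (hasDerivAt_id r).mul_const (Real.cos θ)
    · simpa [polarPoint] using (hasDerivAt_id r).mul_const (Real.sin θ)
  have h := ((hφ.differentiable (by simp) (polarPoint (r, θ))).hasFDerivAt.comp_hasDerivAt r hP)
  have h2 := (hasDerivAt_plane.1 h) j
  simpa [partialDeriv, map_add, map_smul] using h2

theorem hasDerivAt_coord_polarPoint_snd {φ : Plane → Plane} (hφ : ContDiff ℝ ∞ φ) (r θ : ℝ)
    (j : Fin 2) : HasDerivAt (fun t => φ (polarPoint (r, t)) j)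
      (-(r * Real.sin θ) * partialDeriv 0 φ (polarPoint (r, θ)) j +
        r * Real.cos θ * partialDeriv 1 φ (polarPoint (r, θ)) j) θ := by
  have hP : HasDerivAt (fun t => polarPoint (r, t))
      (-(r * Real.sin θ) • EuclideanSpace.single 0 1 +
        (r * Real.cos θ) • EuclideanSpace.single 1 1) θ := by
    rw [hasDerivAt_plane]
    intro i
    fin_cases i
    · simpa [polarPoint] using (Real.hasDerivAt_cos θ).const_mul r
    · simpa [polarPoint] using (Real.hasDerivAt_sin θ).const_mul r
  have h := ((hφ.differentiable (by simp) (polarPoint (r, θ))).hasFDerivAt.comp_hasDerivAt θ hP)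
  have h2 := (hasDerivAt_plane.1 h) j
  simpa [partialDeriv, map_add, map_smul] using h2

theorem fderiv_apply_of_hasDerivAt_fst {f : ℝ × ℝ → ℝ} {r θ d : ℝ}
    (hf : DifferentiableAt ℝ f (r, θ)) (h : HasDerivAt (fun t => f (t, θ)) d r) :
    fderiv ℝ f (r, θ) (1, 0) = d :=
  (hf.hasFDerivAt.comp_hasDerivAt r ((hasDerivAt_id r).prodMk (hasDerivAt_const r θ))).unique h

theorem fderiv_apply_of_hasDerivAt_snd {f : ℝ × ℝ → ℝ} {r θ d : ℝ}
    (hf : DifferentiableAt ℝ f (r, θ)) (h : HasDerivAt (fun t => f (r, t)) d θ) :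
    fderiv ℝ f (r, θ) (0, 1) = d :=
  (hf.hasFDerivAt.comp_hasDerivAt θ ((hasDerivAt_const θ r).prodMk (hasDerivAt_id θ))).unique h

/-- The divergence theorem in the annulus for the field that is, in polar coordinates,
`F φ_r e_r + (F + r² E) φ_θ e_θ`, where `F' = r E` and `F` vanishes on the inner circle. -/
theorem integral_annulus_radial_weight {R₁ R₂ : ℝ} (hR₁ : 0 < R₁) (hR : R₁ < R₂) {E F : ℝ → ℝ}
    (hE : ContDiff ℝ 1 E) (hF : ∀ r, HasDerivAt F (E (r ^ 2) * r) r) (hF₁ : F R₁ = 0)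
    {φ : Plane → Plane} (hφ : ContDiff ℝ ∞ φ) :
    ∫ x in annulus R₁ R₂, (E (‖x‖ ^ 2) * (∑ i, ∑ j, perp x i * partialDeriv i φ x j * perp x j) +
        F ‖x‖ * ∑ i, partialDeriv i φ x i) =
      F R₂ * ∫ x, inner ℝ (φ x) (radialUnit x) ∂(arcLength R₂) := by
  have hF1 : ContDiff ℝ 1 F := by
    have hd : deriv F = fun r => E (r ^ 2) * r := funext fun r => (hF r).deriv
    refine contDiff_one_iff_deriv.2 ⟨fun r => (hF r).differentiableAt, ?_⟩
    rw [hd]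
    have := hE.continuous
    fun_prop
  have hc : ∀ j, ContDiff ℝ 1 fun p : ℝ × ℝ => φ (polarPoint p) j := fun j => by
    exact contDiff_euclidean.1 ((hφ.comp contDiff_polarPoint).of_le (by exact_mod_cast le_top)) j
  have hEc := hE.continuous
  have hFc := hF1.continuous
  have hc0 := hc 0
  have hc1 := hc 1
  -- `f = r F φ_r` and `g = (r² E + F) φ_θ`, so that `∂_r f + ∂_θ g` is `r` times the integrand: the
  -- Jacobian is already included.
  set f : ℝ × ℝ → ℝ := fun p => p.1 * F p.1 *
    (φ (polarPoint p) 0 * Real.cos p.2 + φ (polarPoint p) 1 * Real.sin p.2) with hf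
  set g : ℝ × ℝ → ℝ := fun p => (E (p.1 ^ 2) * p.1 ^ 2 + F p.1) *
    (φ (polarPoint p) 1 * Real.cos p.2 - φ (polarPoint p) 0 * Real.sin p.2) with hg
  have hfC : ContDiff ℝ 1 f := by
    have := hF1.comp (contDiff_fst : ContDiff ℝ 1 (Prod.fst : ℝ × ℝ → ℝ))
    simp only [Function.comp_def] at this
    fun_prop
  have hgC : ContDiff ℝ 1 g := by
    have := hF1.comp (contDiff_fst : ContDiff ℝ 1 (Prod.fst : ℝ × ℝ → ℝ))
    have h2 := hE.comp (contDiff_fst.pow 2 : ContDiff ℝ 1 (fun p : ℝ × ℝ => p.1 ^ 2))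
    simp only [Function.comp_def] at this h2
    fun_prop
  have hdiv : ∀ p : ℝ × ℝ, 0 ≤ p.1 → fderiv ℝ f p (1, 0) + fderiv ℝ g p (0, 1) =
      p.1 * (E (‖polarPoint p‖ ^ 2) * (∑ i, ∑ j, perp (polarPoint p) i *
        partialDeriv i φ (polarPoint p) j * perp (polarPoint p) j) +
        F ‖polarPoint p‖ * ∑ i, partialDeriv i φ (polarPoint p) i) := by
    rintro ⟨r, θ⟩ hr
    rw [fderiv_apply_of_hasDerivAt_fst (hfC.differentiable (by simp) (r, θ))
      (((hasDerivAt_id r).mul (hF r)).mul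
        (((hasDerivAt_coord_polarPoint_fst hφ r θ 0).mul_const (Real.cos θ)).add
          ((hasDerivAt_coord_polarPoint_fst hφ r θ 1).mul_const (Real.sin θ)))),
      fderiv_apply_of_hasDerivAt_snd (hgC.differentiable (by simp) (r, θ))
      ((((hasDerivAt_coord_polarPoint_snd hφ r θ 1).mul (Real.hasDerivAt_cos θ)).sub
          ((hasDerivAt_coord_polarPoint_snd hφ r θ 0).mul (Real.hasDerivAt_sin θ))).const_mul
            (E (r ^ 2) * r ^ 2 + F r)), norm_polarPoint hr]
    have hp0 : perp (polarPoint (r, θ)) 0 = -(r * Real.sin θ) := rfl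
    have hp1 : perp (polarPoint (r, θ)) 1 = r * Real.cos θ := rfl
    simp only [Fin.sum_univ_two, hp0, hp1, id]
    simp only [Pi.mul_apply, id]
    generalize partialDeriv 0 φ (polarPoint (r, θ)) 0 = a
    generalize partialDeriv 0 φ (polarPoint (r, θ)) 1 = b
    generalize partialDeriv 1 φ (polarPoint (r, θ)) 0 = c
    generalize partialDeriv 1 φ (polarPoint (r, θ)) 1 = d
    generalize φ (polarPoint (r, θ)) 0 = A
    generalize φ (polarPoint (r, θ)) 1 = B
    linear_combination (r * F r * (a + d)) * Real.sin_sq_add_cos_sq θ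
  -- The edges `θ = ±π` of the rectangle cancel; with `F R₁ = 0`, only the outer circle remains.
  have hper : ∀ r, g (r, Real.pi) = g (r, -Real.pi) := by
    intro r
    simp [hg, polarPoint]
  have hpi := Real.pi_pos
  have main := integral_divergence_prod_Icc_of_hasFDerivAt_of_le f g (fderiv ℝ f) (fderiv ℝ g)
    (R₁, -Real.pi) (R₂, Real.pi) (Prod.mk_le_mk.2 ⟨hR.le, by linarith⟩)
    hfC.continuous.continuousOn hgC.continuous.continuousOn
    (fun x _ => (hfC.differentiable (by simp) x).hasFDerivAt)
    (fun x _ => (hgC.differentiable (by simp) x).hasFDerivAt)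
    ((((hfC.continuous_fderiv (by simp)).clm_apply continuous_const).add
      ((hgC.continuous_fderiv (by simp)).clm_apply
        continuous_const)).continuousOn.integrableOn_compact isCompact_Icc)
  have hae : (Ioo R₁ R₂ ×ˢ Ioo (-Real.pi) Real.pi : Set (ℝ × ℝ)) =ᵐ[volume]
      Icc (R₁, -Real.pi) (R₂, Real.pi) := by
    rw [← Icc_prod_Icc]
    exact Measure.set_prod_ae_eq Ioo_ae_eq_Icc Ioo_ae_eq_Icc
  rw [integral_annulus_eq_polar hR₁, integral_arcLength_radial (hR₁.trans hR) hφ.continuous]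
  rw [← setIntegral_congr_set hae] at main
  rw [← setIntegral_congr_fun (measurableSet_Ioo.prod measurableSet_Ioo)
    (fun p hp => hdiv p (hR₁.trans hp.1.1).le), main]
  simp only [hper, sub_self, zero_add]
  rw [← intervalIntegral.integral_const_mul]
  have h0 : ∀ θ, f (R₁, θ) = 0 := fun θ => by simp [hf, hF₁]
  simp only [h0, intervalIntegral.integral_zero, sub_zero]
  refine intervalIntegral.integral_congr fun θ _ => ?_
  simp only [hf]
  ring

/-! ### The pair of test fields and their averaged tensor -/

/-- The identification of the plane with `ℂ`. -/
noncomputable def planeToComplex : Plane →L[ℝ] ℂ :=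
  Complex.ofRealCLM.comp (EuclideanSpace.proj 0) +
    (EuclideanSpace.proj 1 : Plane →L[ℝ] ℝ).smulRight Complex.I

theorem planeToComplex_re (x : Plane) : (planeToComplex x).re = x 0 := by
  simp [planeToComplex]

theorem planeToComplex_im (x : Plane) : (planeToComplex x).im = x 1 := by
  simp [planeToComplex]

/-- The function `η(|x|²) zᵏ`, with `z = x₀ + i x₁`. -/
noncomputable def radialPow (η : ℝ → ℝ) (k : ℕ) (x : Plane) : ℂ :=
  η (‖x‖ ^ 2) • planeToComplex x ^ k

theorem contDiff_radialPow {η : ℝ → ℝ} (hη : ContDiff ℝ ∞ η) (k : ℕ) :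
    ContDiff ℝ ∞ (radialPow η k) :=
  (hη.comp (contDiff_norm_sq ℝ)).smul (planeToComplex.contDiff.pow k)

theorem partialDeriv_radialPow {η : ℝ → ℝ} (hη : ContDiff ℝ ∞ η) (n : ℕ) (a : Fin 2) (x : Plane) :
    partialDeriv a (radialPow η (n + 1)) x = planeToComplex x ^ n *
      ((2 * x a * deriv η (‖x‖ ^ 2) : ℝ) * planeToComplex x +
        ((n + 1) * η (‖x‖ ^ 2) : ℝ) * planeToComplex (EuclideanSpace.single a 1)) := by
  have h1 : HasFDerivAt (fun y : Plane => η (‖y‖ ^ 2)) _ x :=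
    (hη.differentiable (by simp) (‖x‖ ^ 2)).hasDerivAt.comp_hasFDerivAt x
      (hasStrictFDerivAt_norm_sq x).hasFDerivAt
  have h2 := planeToComplex.hasFDerivAt (x := x) |>.pow (n + 1)
  have h := (h1.smul h2).fderiv
  have h' : fderiv ℝ (radialPow η (n + 1)) x = _ := h
  rw [partialDeriv, h']
  simp [EuclideanSpace.inner_single_right]
  ring

theorem partialDeriv_re {w : Plane → ℂ} {x : Plane} (hw : DifferentiableAt ℝ w x) (a : Fin 2) :
    partialDeriv a (fun y => (w y).re) x = (partialDeriv a w x).re := by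
  have h : fderiv ℝ (fun y => (w y).re) x = _ :=
    (Complex.reCLM.hasFDerivAt.comp x hw.hasFDerivAt).fderiv
  simp [partialDeriv, h]

theorem partialDeriv_im {w : Plane → ℂ} {x : Plane} (hw : DifferentiableAt ℝ w x) (a : Fin 2) :
    partialDeriv a (fun y => (w y).im) x = (partialDeriv a w x).im := by
  have h : fderiv ℝ (fun y => (w y).im) x = _ :=
    (Complex.imCLM.hasFDerivAt.comp x hw.hasFDerivAt).fderiv
  simp [partialDeriv, h]

/-- The left side is `Re (∂_a w · conj (∂_b w))`. The common factor `zⁿ` of both derivatives enters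
only through its modulus, which removes the oscillation in the angle. -/
theorem sum_partialDeriv_radialPow {η : ℝ → ℝ} (hη : ContDiff ℝ ∞ η) (n : ℕ) (a b : Fin 2)
    (x : Plane) :
    partialDeriv a (fun y => (radialPow η (n + 1) y).re) x *
        partialDeriv b (fun y => (radialPow η (n + 1) y).re) x +
      partialDeriv a (fun y => (radialPow η (n + 1) y).im) x *
        partialDeriv b (fun y => (radialPow η (n + 1) y).im) x =
      (‖x‖ ^ 2) ^ n * ((4 * ‖x‖ ^ 2 * deriv η (‖x‖ ^ 2) ^ 2 +
        4 * (n + 1) * η (‖x‖ ^ 2) * deriv η (‖x‖ ^ 2)) * (x a * x b) +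
        if a = b then ((n + 1) * η (‖x‖ ^ 2)) ^ 2 else 0) := by
  have hd := (contDiff_radialPow hη (n + 1)).differentiable (by simp) x
  rw [partialDeriv_re hd, partialDeriv_re hd, partialDeriv_im hd, partialDeriv_im hd,
    partialDeriv_radialPow hη, partialDeriv_radialPow hη]
  have hs := norm_sq_eq_coord x
  have hz : (planeToComplex x ^ n).re ^ 2 + (planeToComplex x ^ n).im ^ 2 = (‖x‖ ^ 2) ^ n := by
    have h := map_pow Complex.normSq (planeToComplex x) n
    rw [Complex.normSq_apply, Complex.normSq_apply, planeToComplex_re, planeToComplex_im] at h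
    rw [hs]
    linear_combination h
  rw [← hz]
  generalize deriv η (‖x‖ ^ 2) = d
  generalize η (‖x‖ ^ 2) = e
  rw [hs]
  generalize planeToComplex x ^ n = Z
  fin_cases a <;> fin_cases b <;>
    simp [planeToComplex_re, planeToComplex_im] <;> ring

/-- The weight of `x^⊥ ⊗ x^⊥` in the sum of the tensors `-u ⊗ u` of the two fields with the stream
functions `Re` and `Im` of `β(|x|²) |x|^{-2m} z^{2m+2}`, up to a multiple of the identity. -/
noncomputable def streamWeight (β : ℝ → ℝ) (m : ℕ) (s : ℝ) : ℝ :=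
  4 * (m + 1) ^ 2 * β s ^ 2 - 4 * (β s + s * deriv β s) ^ 2

/-- The only danger is `s = 0`, and there `β` vanishes in a whole neighbourhood. -/
theorem contDiff_div_pow {β : ℝ → ℝ} (hβ : ContDiff ℝ ∞ β) (h0 : (0 : ℝ) ∉ tsupport β) (m : ℕ) :
    ContDiff ℝ ∞ fun s => β s / s ^ m := by
  refine contDiff_iff_contDiffAt.2 fun s => ?_
  rcases eq_or_ne s 0 with rfl | hs
  · have h : β =ᶠ[𝓝 0] 0 := notMem_tsupport_iff_eventuallyEq.1 h0
    refine (contDiffAt_const (c := (0 : ℝ))).congr_of_eventuallyEq (h.mono fun s hs => ?_)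
    simp [hs]
  · exact hβ.contDiffAt.div (contDiffAt_id.pow m) (pow_ne_zero m hs)

/-- The stream functions of the two test fields are the real and imaginary parts of this one. -/
noncomputable def testStream (β : ℝ → ℝ) (m : ℕ) : Plane → ℂ :=
  radialPow (fun s => β s / s ^ m) (2 * m + 1 + 1)

/-- The summed tensor is a radial multiple of `x^⊥ ⊗ x^⊥` plus a multiple of the identity, and the
latter meets only the trace of `A`. -/
theorem sum_streamField_quadratic {β : ℝ → ℝ} (hβ : ContDiff ℝ ∞ β) (h0 : (0 : ℝ) ∉ tsupport β)
    (m : ℕ) {x : Plane} (hx : x ≠ 0) (A : Fin 2 → Plane) (hA : ∑ i, A i i = 0) :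
    -(∑ i, ∑ j, streamField (fun y => (testStream β m y).re) x i * A i j *
        streamField (fun y => (testStream β m y).re) x j) +
      -(∑ i, ∑ j, streamField (fun y => (testStream β m y).im) x i * A i j *
        streamField (fun y => (testStream β m y).im) x j) =
      streamWeight β m (‖x‖ ^ 2) * ∑ i, ∑ j, perp x i * A i j * perp x j := by
  have hη := contDiff_div_pow hβ h0 m
  have hs : ‖x‖ ^ 2 ≠ 0 := by simpa using hx
  have hd : deriv (fun s => β s / s ^ m) (‖x‖ ^ 2) =
      (‖x‖ ^ 2 * deriv β (‖x‖ ^ 2) - m * β (‖x‖ ^ 2)) / (‖x‖ ^ 2) ^ (m + 1) := by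
    have h : deriv (fun s => β s / s ^ m) (‖x‖ ^ 2) = _ :=
      ((hβ.differentiable (by simp) (‖x‖ ^ 2)).hasDerivAt.div (hasDerivAt_pow m (‖x‖ ^ 2))
        (pow_ne_zero m hs)).deriv
    rw [h]
    generalize ‖x‖ ^ 2 = s at hs ⊢
    -- The derivative of `s ^ m` carries the truncated exponent `m - 1`, so `m = 0` is separate.
    rcases m with _ | m
    · simp
      field_simp
    · rw [Nat.add_sub_cancel]
      field_simp
      ring
  have key : (‖x‖ ^ 2) ^ (2 * m + 1) * (4 * ‖x‖ ^ 2 * deriv (fun s => β s / s ^ m) (‖x‖ ^ 2) ^ 2 +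
        4 * ((2 * m + 1 : ℕ) + 1) * (β (‖x‖ ^ 2) / (‖x‖ ^ 2) ^ m) *
          deriv (fun s => β s / s ^ m) (‖x‖ ^ 2)) = -streamWeight β m (‖x‖ ^ 2) := by
    rw [hd, streamWeight]
    generalize ‖x‖ ^ 2 = s at hs ⊢
    push_cast
    field_simp
    ring
  have h00 := sum_partialDeriv_radialPow hη (2 * m + 1) 0 0 x
  have h01 := sum_partialDeriv_radialPow hη (2 * m + 1) 0 1 x
  have h11 := sum_partialDeriv_radialPow hη (2 * m + 1) 1 1 x
  rw [mul_add, ← mul_assoc, key] at h00 h01 h11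
  simp only [if_true, if_neg (zero_ne_one : (0 : Fin 2) ≠ 1), mul_zero, add_zero] at h00 h01 h11
  rw [Fin.sum_univ_two] at hA
  have e0 : ∀ ψ : Plane → ℝ, streamField ψ x 0 = partialDeriv 1 ψ x := fun _ => rfl
  have e1 : ∀ ψ : Plane → ℝ, streamField ψ x 1 = -partialDeriv 0 ψ x := fun _ => rfl
  have p0 : perp x 0 = -x 1 := rfl
  have p1 : perp x 1 = x 0 := rfl
  simp only [Fin.sum_univ_two, e0, e1, p0, p1, testStream]
  -- The rotation by a right angle in `streamField` exchanges the indices, so `h11` goes with `A 0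
  -- 0`; the coefficient of `hA` is the identity part.
  linear_combination (-A 0 0) * h11 + (A 0 1 + A 1 0) * h01 - A 1 1 * h00 -
    ((‖x‖ ^ 2) ^ (2 * m + 1) * (((2 * m + 1 : ℕ) + 1) * (β (‖x‖ ^ 2) / (‖x‖ ^ 2) ^ m)) ^ 2) * hA

theorem tsupport_testStream_subset (β : ℝ → ℝ) (m : ℕ) :
    tsupport (testStream β m) ⊆ {x | ‖x‖ ^ 2 ∈ tsupport β} := by
  refine closure_minimal (fun x hx => ?_)
    ((isClosed_tsupport β).preimage (continuous_norm.pow 2))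
  by_contra h
  refine hx ?_
  simp [testStream, radialPow, image_eq_zero_of_notMem_tsupport h]

theorem testStream_test_field {R₁ R₂ : ℝ} (hR₁ : 0 < R₁) (hR : R₁ < R₂) {β : ℝ → ℝ}
    (hβ : ContDiff ℝ ∞ β) (hs : tsupport β ⊆ Ioo (R₁ ^ 2) (R₂ ^ 2)) (m : ℕ) (L : ℂ →L[ℝ] ℝ) :
    ContDiff ℝ ∞ (fun y => L (testStream β m y)) ∧
      HasCompactSupport (fun y => L (testStream β m y)) ∧
      tsupport (fun y => L (testStream β m y)) ⊆ annulus R₁ R₂ := by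
  have h0 : (0 : ℝ) ∉ tsupport β := fun h => absurd (hs h).1 (sq_nonneg R₁).not_gt
  have hsub : tsupport (fun y => L (testStream β m y)) ⊆ annulus R₁ R₂ := by
    refine (tsupport_comp_subset (map_zero L) _).trans
      ((tsupport_testStream_subset β m).trans fun x hx => ?_)
    have h := hs hx
    exact ⟨lt_of_pow_lt_pow_left₀ 2 (norm_nonneg x) h.1,
      lt_of_pow_lt_pow_left₀ 2 (hR₁.trans hR).le h.2⟩
  refine ⟨L.contDiff.comp (contDiff_radialPow (contDiff_div_pow hβ h0 m) _), ?_, hsub⟩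
  exact (isCompact_closedBall (0 : Plane) R₂).of_isClosed_subset (isClosed_tsupport _)
    (hsub.trans fun x hx => by simpa using hx.2.le)

/-! ### Positivity of the weight for large wave numbers -/

/-- There are a profile and a wave number for which the weight has a positive integral. -/
theorem exists_streamWeight_integral_pos {R₁ R₂ : ℝ} (hR₁ : 0 < R₁) (hR : R₁ < R₂) :
    ∃ (β : ℝ → ℝ) (m : ℕ), ContDiff ℝ ∞ β ∧ tsupport β ⊆ Ioo (R₁ ^ 2) (R₂ ^ 2) ∧
      0 < ∫ r in R₁..R₂, streamWeight β m (r ^ 2) * r := by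
  have hsq : R₁ ^ 2 < R₂ ^ 2 := by gcongr
  -- In the variable `s = r²`: the outer radius is half of the half-length of `(R₁², R₂²)`, so the
  -- closed support stays inside.
  let b : ContDiffBump ((R₁ ^ 2 + R₂ ^ 2) / 2) :=
    ⟨(R₂ ^ 2 - R₁ ^ 2) / 8, (R₂ ^ 2 - R₁ ^ 2) / 4, by linarith, by linarith⟩
  have hb : ContDiff ℝ ∞ b := b.contDiff
  have hbc := hb.continuous
  have hbd : Continuous (deriv b) := hb.continuous_deriv (by simp)
  have hA : 0 < ∫ r in R₁..R₂, b (r ^ 2) ^ 2 * r := by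
    refine intervalIntegral.integral_pos hR (by fun_prop) (fun r hr => ?_) ?_
    · have := hR₁.trans hr.1
      positivity
    · have hc : 0 ≤ (R₁ ^ 2 + R₂ ^ 2) / 2 := by positivity
      refine ⟨√((R₁ ^ 2 + R₂ ^ 2) / 2), ⟨?_, ?_⟩, ?_⟩
      · exact Real.le_sqrt_of_sq_le (by linarith)
      · exact Real.sqrt_le_iff.2 ⟨by linarith, by linarith⟩
      · rw [Real.sq_sqrt hc]
        have h1 : 0 < b ((R₁ ^ 2 + R₂ ^ 2) / 2) :=
          b.pos_of_mem_ball (Metric.mem_ball_self b.rOut_pos)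
        have h2 : 0 < √((R₁ ^ 2 + R₂ ^ 2) / 2) := Real.sqrt_pos.2 (by positivity)
        positivity
  set A := ∫ r in R₁..R₂, b (r ^ 2) ^ 2 * r with hAdef
  set B := ∫ r in R₁..R₂, (b (r ^ 2) + r ^ 2 * deriv b (r ^ 2)) ^ 2 * r with hBdef
  -- The integral of the weight is `4(m+1)² A - 4B`, where neither `A > 0` nor `B` depends on `m`.
  obtain ⟨m, hm⟩ := exists_nat_gt (B / A)
  refine ⟨b, m, hb, ?_, ?_⟩
  · rw [b.tsupport_eq, Real.closedBall_eq_Icc]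
    exact Icc_subset_Ioo (by change _ < _ - (R₂ ^ 2 - R₁ ^ 2) / 4; linarith)
      (by change _ + (R₂ ^ 2 - R₁ ^ 2) / 4 < _; linarith)
  · have h : ∫ r in R₁..R₂, streamWeight b m (r ^ 2) * r = 4 * (m + 1) ^ 2 * A - 4 * B := by
      rw [hAdef, hBdef, ← intervalIntegral.integral_const_mul,
        ← intervalIntegral.integral_const_mul, ← intervalIntegral.integral_sub
          (Continuous.intervalIntegrable (by fun_prop) _ _)
          (Continuous.intervalIntegrable (by fun_prop) _ _)]
      refine intervalIntegral.integral_congr fun r _ => ?_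
      simp only [streamWeight]
      ring
    rw [h]
    have h1 : B < m * A := (div_lt_iff₀ hA).1 hm
    have h2 : (m : ℝ) * A ≤ (m + 1) ^ 2 * A := by
      gcongr
      nlinarith [(Nat.cast_nonneg m : (0 : ℝ) ≤ m)]
    linarith

/-! ### Passage from smooth fields to `W^{1,2}` -/

section InnerProductIntegrals

variable {α E : Type*} [MeasurableSpace α] [NormedAddCommGroup E] [InnerProductSpace ℝ E]
  {μ : Measure α}

theorem integrable_inner_of_memLp {f g : α → E} (hf : MemLp f 2 μ) (hg : MemLp g 2 μ) :
    Integrable (fun x => inner ℝ (f x) (g x)) μ :=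
  memLp_one_iff_integrable.1 (MemLp.of_bilin (p := 2) (q := 2) (fun a b => inner ℝ a b) 1 hf hg
    (hf.1.inner hg.1) (Eventually.of_forall fun x => by
      simpa [← NNReal.coe_le_coe] using abs_real_inner_le_norm (f x) (g x)))

/-- Cauchy–Schwarz. The `f i k` lie in `L²` only eventually, once their distance to `g i` is finite.
-/
theorem tendsto_integral_sum_inner {ι : Type*} [Fintype ι]
    {f : ι → ℕ → α → E} {g W : ι → α → E} (hf : ∀ i k, AEStronglyMeasurable (f i k) μ)
    (hg : ∀ i, MemLp (g i) 2 μ) (hW : ∀ i, MemLp (W i) 2 μ)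
    (h : ∀ i, Tendsto (fun k => eLpNorm (fun x => f i k x - g i x) 2 μ) atTop (𝓝 0)) :
    Tendsto (fun k => ∫ x, ∑ i, inner ℝ (f i k x) (W i x) ∂μ) atTop
      (𝓝 (∫ x, ∑ i, inner ℝ (g i x) (W i x) ∂μ)) := by
  have hfL : ∀ i, ∀ᶠ k in atTop, MemLp (f i k) 2 μ := fun i => by
    filter_upwards [(h i).eventually (gt_mem_nhds ENNReal.zero_lt_top)] with k hk
    have := (show MemLp (fun x => f i k x - g i x) 2 μ from
      ⟨(hf i k).sub (hg i).1, hk⟩).add (hg i)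
    exact this.congr_norm (hf i k) (Eventually.of_forall fun x => by simp)
  rw [integral_finsetSum _ fun i _ => integrable_inner_of_memLp (hg i) (hW i)]
  refine Tendsto.congr' (f₁ := fun k => ∑ i, ∫ x, inner ℝ (f i k x) (W i x) ∂μ) ?_
    (tendsto_finsetSum _ fun i _ => ?_)
  · filter_upwards [eventually_all.2 hfL] with k hk
    rw [integral_finsetSum _ fun i _ => integrable_inner_of_memLp (hk i) (hW i)]
  refine tendsto_integral_of_L1' _ (integrable_inner_of_memLp (hg i) (hW i)).1
    ((hfL i).mono fun k hk => integrable_inner_of_memLp hk (hW i)) ?_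
  have hlim : Tendsto (fun k => eLpNorm (fun x => f i k x - g i x) 2 μ * eLpNorm (W i) 2 μ) atTop
      (𝓝 0) := by
    simpa using ENNReal.Tendsto.mul_const (h i) (Or.inr (hW i).2.ne)
  refine tendsto_of_tendsto_of_tendsto_of_le_of_le tendsto_const_nhds hlim (fun _ => zero_le)
    fun k => ?_
  have hle := eLpNorm_le_eLpNorm_mul_eLpNorm'_of_norm (p := 2) (q := 2) (r := 1)
    ((hf i k).sub (hg i).1) (hW i).1
    (fun a b => inner ℝ a b) 1 (Eventually.of_forall fun x => by
      simpa using abs_real_inner_le_norm (f i k x - g i x) (W i x))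
  rw [ENNReal.coe_one, one_mul] at hle
  refine le_trans (le_of_eq ?_) hle
  congr 1
  ext x
  simp [inner_sub_left]

end InnerProductIntegrals

theorem Continuous.memLp_annulus {W : Plane → Plane} (hW : Continuous W) (R₁ R₂ : ℝ) :
    MemLp W 2 (volume.restrict (annulus R₁ R₂)) := by
  have hsub : annulus R₁ R₂ ⊆ Metric.closedBall 0 R₂ := fun x hx => by simpa using hx.2.le
  have : IsFiniteMeasure (volume.restrict (annulus R₁ R₂)) :=
    ⟨by simpa using (measure_mono hsub).trans_lt measure_closedBall_lt_top⟩
  obtain ⟨C, hC⟩ := (isCompact_closedBall (0 : Plane) R₂).exists_bound_of_continuousOn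
    hW.continuousOn
  exact MemLp.of_bound hW.aestronglyMeasurable C
    ((ae_restrict_iff' (measurableSet_annulus R₁ R₂)).2
      (Eventually.of_forall fun x hx => hC x (hsub hx)))

theorem isFiniteMeasure_arcLength (R : ℝ) : IsFiniteMeasure (arcLength R) :=
  Measure.smul_finite _ ENNReal.ofReal_ne_top

theorem memLp_radialUnit (R : ℝ) : MemLp radialUnit 2 (arcLength R) := by
  have := isFiniteMeasure_arcLength R
  have hm : Measurable radialUnit := (measurable_norm.inv).smul measurable_id
  refine MemLp.of_bound hm.aestronglyMeasurable 1 (Eventually.of_forall fun x => ?_)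
  rw [radialUnit, norm_smul, norm_inv, norm_norm]
  exact inv_mul_le_one

/-- The flux determines the integral of `∇V` against a radial multiple of `x^⊥ ⊗ x^⊥`. -/
theorem integral_annulus_perp_eq_flux {R₁ R₂ : ℝ} (hR₁ : 0 < R₁) (hR : R₁ < R₂) {w : ℝ → ℝ}
    (hw : ContDiff ℝ 1 w) {vStar V : Plane → Plane} {G : Fin 2 → Plane → Plane}
    (hv : MemLp vStar 2 (annulusBoundaryMeasure R₁ R₂)) (hV : MemW12 (annulus R₁ R₂) V G)
    (hG : IsSolenoidal (annulus R₁ R₂) G)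
    (hT : HasTrace (annulus R₁ R₂) (annulusBoundaryMeasure R₁ R₂) V G vStar) :
    ∫ x in annulus R₁ R₂, w (‖x‖ ^ 2) * ∑ i, ∑ j, perp x i * G i x j * perp x j =
      (∫ r in R₁..R₂, w (r ^ 2) * r) *
        ∫ x, inner ℝ (vStar x) (radialUnit x) ∂(arcLength R₂) := by
  obtain ⟨φ, hφ, ⟨-, hφG⟩, hφv⟩ := hT
  have hwc := hw.continuous
  set F : ℝ → ℝ := fun r => ∫ t in R₁..r, w (t ^ 2) * t
  have hF : ∀ r, HasDerivAt F (w (r ^ 2) * r) r := fun r =>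
    (show Continuous fun t => w (t ^ 2) * t by fun_prop).integral_hasStrictDerivAt R₁ r
      |>.hasDerivAt
  have hFc : Continuous F := continuous_iff_continuousAt.2 fun r => (hF r).continuousAt
  have hpc : Continuous perp := by
    refine (PiLp.continuous_toLp 2 _).comp (continuous_pi fun i => ?_)
    fin_cases i
    · exact (by fun_prop : Continuous fun x : Plane => -x 1)
    · exact (by fun_prop : Continuous fun x : Plane => x 0)
  -- Chosen so that pairing a gradient with `W` gives the integrand of the identity for smooth
  -- fields; the `F` part keeps the divergence of the approximants, which need not vanish.
  let W : Fin 2 → Plane → Plane := fun i x =>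
    (w (‖x‖ ^ 2) * perp x i) • perp x + F ‖x‖ • EuclideanSpace.single i 1
  have hW : ∀ i, MemLp (W i) 2 (volume.restrict (annulus R₁ R₂)) := fun i =>
    (show Continuous (W i) by fun_prop).memLp_annulus R₁ R₂
  have hWsum : ∀ (A : Fin 2 → Plane) (x : Plane), ∑ i, inner ℝ (A i) (W i x) =
      w (‖x‖ ^ 2) * (∑ i, ∑ j, perp x i * A i j * perp x j) + F ‖x‖ * ∑ i, A i i := by
    intro A x
    simp only [W, inner_add_right, inner_smul_right, EuclideanSpace.inner_single_right]
    simp only [Fin.sum_univ_two, PiLp.inner_apply, RCLike.inner_apply, conj_trivial]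
    ring
  have hlim := tendsto_integral_sum_inner (W := W)
    (fun i k => ((hφ k).partialDeriv i).continuous.aestronglyMeasurable) hV.memLp_grad hW hφG
  have hbd : ∀ k, ∫ x in annulus R₁ R₂, ∑ i, inner ℝ (partialDeriv i (φ k) x) (W i x) =
      F R₂ * ∫ x, inner ℝ (φ k x) (radialUnit x) ∂(arcLength R₂) := fun k => by
    simp_rw [hWsum]
    exact integral_annulus_radial_weight hR₁ hR hw hF intervalIntegral.integral_same (hφ k)
  simp_rw [hbd] at hlim
  have hle : arcLength R₂ ≤ annulusBoundaryMeasure R₁ R₂ := Measure.le_add_left le_rfl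
  have hlim₂ := tendsto_integral_sum_inner (ι := Unit) (f := fun _ => φ) (g := fun _ => vStar)
    (W := fun _ => radialUnit) (μ := arcLength R₂)
    (fun _ k => (hφ k).continuous.aestronglyMeasurable) (fun _ => hv.mono_measure hle)
    (fun _ => memLp_radialUnit R₂)
    (fun _ => tendsto_of_tendsto_of_tendsto_of_le_of_le tendsto_const_nhds hφv
      (fun _ => zero_le) fun k => eLpNorm_mono_measure _ hle)
  simp only [Finset.univ_unique, Finset.sum_singleton] at hlim₂
  rw [← tendsto_nhds_unique hlim (hlim₂.const_mul (F R₂))]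
  refine integral_congr_ae (hG.mono fun x hx => ?_)
  simp only
  rw [hWsum, hx, mul_zero, add_zero]

/-- `G` is only in `L²`, but `u i • u` is continuous with compact support, hence also in `L²`. -/
theorem integrable_convectiveForm {Ω : Set Plane} {G : Fin 2 → Plane → Plane}
    (hG : ∀ i, MemLp (G i) 2 (volume.restrict Ω)) {u : Plane → Plane} (hu : Continuous u)
    (hc : HasCompactSupport u) :
    Integrable (fun x => ∑ i, ∑ j, u x i * G i x j * u x j) (volume.restrict Ω) := by
  have h : ∀ i, Integrable (fun x => inner ℝ (G i x) (u x i • u x)) (volume.restrict Ω) :=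
    fun i => integrable_inner_of_memLp (hG i) (Continuous.memLp_of_hasCompactSupport (by fun_prop)
      (hc.smul_left (f := fun x => u x i)))
  refine (integrable_finsetSum Finset.univ fun i _ => h i).congr (Eventually.of_forall fun x => ?_)
  simp only [Fin.sum_univ_two, inner_smul_right, PiLp.inner_apply, RCLike.inner_apply,
    conj_trivial]
  ring

/-! ### The contradiction for small `ε` -/

theorem mainTheorem1 (R₁ R₂ : ℝ) (hR₁ : 0 < R₁) (hR : R₁ < R₂)
    (vStar : Plane → Plane) (hv : MemLp vStar 2 (annulusBoundaryMeasure R₁ R₂))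
    (Φ : ℝ)
    (hΦ₂ : ∫ x, inner ℝ (vStar x) (radialUnit x) ∂(arcLength R₂) = Φ)
    (hΦ₁ : ∫ x, inner ℝ (vStar x) (-radialUnit x) ∂(arcLength R₁) = -Φ)
    (hΦ : 0 < Φ) :
    ¬ LerayHopfExtensionCondition (annulus R₁ R₂) (annulusBoundaryMeasure R₁ R₂) vStar := by
  intro hLH
  obtain ⟨β, m, hβ, hs, hpos⟩ := exists_streamWeight_integral_pos hR₁ hR
  have h0 : (0 : ℝ) ∉ tsupport β := fun h => absurd (hs h).1 (sq_nonneg R₁).not_gt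
  have hwC : ContDiff ℝ 1 (streamWeight β m) := by
    have h1 : ContDiff ℝ 1 β := hβ.of_le (by exact_mod_cast le_top)
    have h2 : ContDiff ℝ 1 (deriv β) :=
      (contDiff_infty_iff_deriv.1 hβ).2.of_le (by exact_mod_cast le_top)
    unfold streamWeight
    fun_prop
  obtain ⟨hp, hpc, hps⟩ := testStream_test_field hR₁ hR hβ hs m Complex.reCLM
  obtain ⟨hq, hqc, hqs⟩ := testStream_test_field hR₁ hR hβ hs m Complex.imCLM
  set ψ₁ : Plane → ℝ := fun y => Complex.reCLM (testStream β m y)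
  set ψ₂ : Plane → ℝ := fun y => Complex.imCLM (testStream β m y)
  set K := dirichletEnergy (annulus R₁ R₂) (fun i => partialDeriv i (streamField ψ₁)) +
    dirichletEnergy (annulus R₁ R₂) (fun i => partialDeriv i (streamField ψ₂))
  set c := (∫ r in R₁..R₂, streamWeight β m (r ^ 2) * r) * Φ with hc
  have hcpos : 0 < c := mul_pos hpos hΦ
  -- This `ε` makes `ε K < c`; `|K| + 1` is positive without knowing the sign of `K`.
  obtain ⟨V, G, hV, hG, hT, hu⟩ := hLH (c / (|K| + 1)) (by positivity)
  have h₁ := hu _ _ (memW12Zero_streamField hp hpc hps) (isSolenoidal_streamField hp _)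
  have h₂ := hu _ _ (memW12Zero_streamField hq hqc hqs) (isSolenoidal_streamField hq _)
  have hcompact : ∀ {ψ : Plane → ℝ}, HasCompactSupport ψ → HasCompactSupport (streamField ψ) :=
    fun h => h.of_isClosed_subset (isClosed_tsupport _) (tsupport_streamField_subset _)
  have hform : -convectiveForm (annulus R₁ R₂) G (streamField ψ₁) +
      -convectiveForm (annulus R₁ R₂) G (streamField ψ₂) = c := by
    have hadd := integral_add
      (integrable_convectiveForm hV.memLp_grad (contDiff_streamField hp).continuous
        (hcompact hpc)).neg
      (integrable_convectiveForm hV.memLp_grad (contDiff_streamField hq).continuous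
        (hcompact hqc)).neg
    simp only [Pi.neg_apply] at hadd
    rw [hc, ← hΦ₂, ← integral_annulus_perp_eq_flux hR₁ hR hwC hv hV hG hT, convectiveForm,
      convectiveForm, ← integral_neg, ← integral_neg, ← hadd]
    refine integral_congr_ae ?_
    filter_upwards [hG, ae_restrict_mem (measurableSet_annulus R₁ R₂)] with x hx hxΩ
    exact sum_streamField_quadratic hβ h0 m (norm_pos_iff.1 (hR₁.trans hxΩ.1))
      (fun i => G i x) hx
  have hle : c ≤ c / (|K| + 1) * K := by
    rw [mul_add]
    linarith
  have hlt : c / (|K| + 1) * K < c := by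
    rw [div_mul_eq_mul_div, div_lt_iff₀ (by positivity)]
    exact mul_lt_mul_of_pos_left ((le_abs_self K).trans_lt (lt_add_one _)) hcpos
  exact absurd hle hlt.not_ge
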